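/- Let $(M,g)$ be a smooth spacetime of dimension $n+1$ ($n\ge 1$, signature $(-,+,\dots,+)$), $\xi$ a vector field on $M$ and $S\subset M$. Suppose that a neighbourhood of $S$ is covered by an atlas of Rácz–Wald coordinates: smooth charts $(U,V,x_{\mathfrak i}^a)$, $a=1,\dots,n-1$, with common functions $U,V$, such that in each chart $S=\{U=V=0\}$, $$ g = G\,dU\,(dV+V q_a dx^a)+\gamma_{ab}\,dx^a dx^b ,\qquad \xi = U\partial_U - V\partial_V , $$ where $G>0$, $q_a$ and the positive definite symmetric $\gamma_{ab}$ are smooth functions of $(UV,x)$ only (so that $\xi$ is a Killing vector and $\{UV=0\}$ is a bifurcate Killing horizon with bifurcation surface $S$). Let $\xi^\flat=g(\xi,\cdot)$, $\lambda=-g(\xi,\xi)$, let $\omega=\tfrac12\,\xi^\flat\wedge d\xi^\flat$ be the twist three-form and $\Omega=i_\xi\omega$. On any one of the four quadrants $\{\pm U>0,\ \pm V>0\}$ let $\pi:(U,V,x)\mapsto(z,x)$, $z=\sqrt{|UV|}>0$, be the projection to the quotient $\Sigma$ by the orbits of $\xi$ in these coordinates, and let $\mathcal B=\lambda^{-2}\hat\Omega$,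 where $\hat\Omega$ is the two-form on $\Sigma$ with $\pi^*\hat\Omega=\Omega$. The boundary $\partial\Sigma\approx S$ is $\{z=0\}$. Let $\zeta(X)=g(k,\nabla_X\ell)$ ($X$ tangent to $S$, $\nabla$ the Levi-Civita connection) be the torsion one-form of $S$, where $k,\ell$ are any smooth null normals to $S$ with $g(k,\ell)=-1$; these may be chosen independently in each chart. Then $\hat\Omega$, and hence $\mathcal B$, exists, and $\mathcal B$ extends smoothly, in the coordinates $(z,x)$, up to and including $\partial\Sigma$. Its continuous extension vanishes (all components $\mathcal B_{ij}$) at every point of $\partial\Sigma$ if and only if $\zeta$ is closed on $S$. -/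

import Mathlib

open Set
open scoped Manifold ContDiff Topology

noncomputable section

namespace RaczWald

/-! ### One-forms and two-forms on a normed space -/

section Forms

variable {E : Type*} [NormedAddCommGroup E] [NormedSpace ℝ E]

/-- The exterior derivative `dα` of a one-form `α`, so that, where `α` is differentiable,
`dα(v, w) = (D_v α)(w) - (D_w α)(v)`. -/
def dOne (α : E → E →L[ℝ] ℝ) (y : E) : E [⋀^Fin 2]→L[ℝ] ℝ :=
  extDeriv (fun y' => ContinuousAlternatingMap.ofSubsingleton ℝ E ℝ (0 : Fin 1) (α y')) y

/-- The one-form `ξ♭ = g(ξ, ·)`. -/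
def flat (g : E → E →L[ℝ] E →L[ℝ] ℝ) (ξ : E → E) (y : E) : E →L[ℝ] ℝ := g y (ξ y)

/-- `λ = - g(ξ, ξ)`. -/
def normSq (g : E → E →L[ℝ] E →L[ℝ] ℝ) (ξ : E → E) (y : E) : ℝ := - g y (ξ y) (ξ y)

/-- The twist three-form `ω = ½ ξ♭ ∧ dξ♭`, that is
`ω_{αβγ} = ξ_α F_{βγ} + ξ_β F_{γα} + ξ_γ F_{αβ}` with `F = ½ dξ♭`. -/
def twist (g : E → E →L[ℝ] E →L[ℝ] ℝ) (ξ : E → E) (y : E) (u v w : E) : ℝ :=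
  (1 / 2 : ℝ) * (flat g ξ y u * dOne (flat g ξ) y ![v, w]
    + flat g ξ y v * dOne (flat g ξ) y ![w, u]
    + flat g ξ y w * dOne (flat g ξ) y ![u, v])

/-- The two-form `Ω = i_ξ ω`. -/
def twistContraction (g : E → E →L[ℝ] E →L[ℝ] ℝ) (ξ : E → E) (y : E) (v w : E) : ℝ :=
  twist g ξ y (ξ y) v w

/-- The Christoffel symbols of the first kind, as a one-form in the direction `X` of
differentiation: `X ↦ Γ_{k,Xℓ} = ½ ((∂_X g)(ℓ, k) + (∂_ℓ g)(X, k) - (∂_k g)(X, ℓ))`.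
It is characterised by `g(k, ∇_X Y) = g(k, ∂_X Y) + Γ_{k,XY}`, for the Levi-Civita
derivative `∇` of `g`. -/
def christoffelFirst (g : E → E →L[ℝ] E →L[ℝ] ℝ) (y k l : E) : E →L[ℝ] ℝ :=
  (1 / 2 : ℝ) • (((fderiv ℝ g y).flip l).flip k + (fderiv ℝ g y l).flip k
    - (fderiv ℝ g y k).flip l)

end Forms

/-! ### Spacetimes -/

/-- A smooth Lorentzian metric, with signature `(-, +, …, +)`, on a manifold of dimension `d`:
at each point there is a timelike vector on whose orthogonal complement the metric is
positive definite. -/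
structure LorentzianMetric (d : ℕ) (M : Type*) [TopologicalSpace M]
    [ChartedSpace (EuclideanSpace ℝ (Fin d)) M] [IsManifold (𝓡 d) ∞ M] where
  inner (p : M) : TangentSpace (𝓡 d) p →L[ℝ] TangentSpace (𝓡 d) p →L[ℝ] ℝ
  symm (p : M) (v w : TangentSpace (𝓡 d) p) : inner p v w = inner p w v
  lorentzian (p : M) : ∃ t : TangentSpace (𝓡 d) p, inner p t t < 0 ∧
    ∀ v : TangentSpace (𝓡 d) p, inner p t v = 0 → v ≠ 0 → 0 < inner p v v
  contMDiff : ContMDiff (𝓡 d)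
    ((𝓡 d).prod 𝓘(ℝ, EuclideanSpace ℝ (Fin d) →L[ℝ] EuclideanSpace ℝ (Fin d) →L[ℝ] ℝ)) ∞
    (fun p => Bundle.TotalSpace.mk'
      (EuclideanSpace ℝ (Fin d) →L[ℝ] EuclideanSpace ℝ (Fin d) →L[ℝ] ℝ)
      (E := fun p : M => TangentSpace (𝓡 d) p →L[ℝ] TangentSpace (𝓡 d) p →L[ℝ] ℝ)
      p (inner p))

/-- The space of the coordinates `x = (x^a)` on the bifurcation surface, of dimension `m`. -/
abbrev XSpace (m : ℕ) : Type := EuclideanSpace ℝ (Fin m)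

/-- The space of the coordinates `(U, V, x)`. -/
abbrev RWSpace (m : ℕ) : Type := ℝ × ℝ × XSpace m

section Coordinates

variable {m : ℕ} {M : Type*} [TopologicalSpace M]
  [ChartedSpace (EuclideanSpace ℝ (Fin (m + 2))) M]

/-- The coordinate expression, in the chart `φ`, of a field of bilinear forms on `M`. -/
def coordBilin (g : ∀ p : M, TangentSpace (𝓡 (m + 2)) p →L[ℝ] TangentSpace (𝓡 (m + 2)) p →L[ℝ] ℝ)
    (φ : OpenPartialHomeomorph M (RWSpace m)) (y : RWSpace m) :
    RWSpace m →L[ℝ] RWSpace m →L[ℝ] ℝ :=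
  let b : EuclideanSpace ℝ (Fin (m + 2)) →L[ℝ] EuclideanSpace ℝ (Fin (m + 2)) →L[ℝ] ℝ :=
    g (φ.symm y)
  let L : RWSpace m →L[ℝ] EuclideanSpace ℝ (Fin (m + 2)) :=
    mfderiv 𝓘(ℝ, RWSpace m) (𝓡 (m + 2)) φ.symm y
  b.bilinearComp L L

/-- The coordinate expression, in the chart `φ`, of a vector field on `M`. -/
def coordVec (ξ : ∀ p : M, TangentSpace (𝓡 (m + 2)) p)
    (φ : OpenPartialHomeomorph M (RWSpace m)) (y : RWSpace m) : RWSpace m :=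
  mfderiv (𝓡 (m + 2)) 𝓘(ℝ, RWSpace m) φ (φ.symm y) (ξ (φ.symm y))

end Coordinates

/-- The map `(U, V, x) ↦ (UV, x)`. -/
def toS {m : ℕ} (y : RWSpace m) : ℝ × XSpace m := (y.1 * y.2.1, y.2.2)

/-- The bilinear form `G dU (dV + V q_a dx^a) + γ_{ab} dx^a dx^b` (symmetrised products) at
the point `y = (U, V, x)`, where `G`, `q`, `γ` are functions of `(UV, x)`. -/
def rwForm {m : ℕ} (G : ℝ × XSpace m → ℝ) (q : ℝ × XSpace m → XSpace m →L[ℝ] ℝ)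
    (γ : ℝ × XSpace m → XSpace m →L[ℝ] XSpace m →L[ℝ] ℝ) (y v w : RWSpace m) : ℝ :=
  G (toS y) / 2 * (v.1 * (w.2.1 + y.2.1 * q (toS y) w.2.2)
    + w.1 * (v.2.1 + y.2.1 * q (toS y) v.2.2)) + γ (toS y) v.2.2 w.2.2

/-- An atlas of Rácz–Wald coordinates `(U, V, x_i)`, `i ∈ ι`, on a neighbourhood of the
bifurcation surface `S` of a bifurcate Killing horizon, for the metric `g` and the Killing
vector `ξ`. The branches of the horizon are `{U = 0}` and `{V = 0}`. -/
structure RWAtlas {m : ℕ} {M : Type*} [TopologicalSpace M]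
    [ChartedSpace (EuclideanSpace ℝ (Fin (m + 2))) M] [IsManifold (𝓡 (m + 2)) ∞ M]
    (g : LorentzianMetric (m + 2) M) (ξ : ∀ p : M, TangentSpace (𝓡 (m + 2)) p)
    (S : Set M) (ι : Type*) where
  U : M → ℝ
  V : M → ℝ
  chart : ι → OpenPartialHomeomorph M (RWSpace m)
  contMDiffOn_chart : ∀ i, ContMDiffOn (𝓡 (m + 2)) 𝓘(ℝ, RWSpace m) ∞ (chart i) (chart i).source
  contMDiffOn_symm : ∀ i,
    ContMDiffOn 𝓘(ℝ, RWSpace m) (𝓡 (m + 2)) ∞ (chart i).symm (chart i).target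
  chart_U : ∀ i, ∀ p ∈ (chart i).source, (chart i p).1 = U p
  chart_V : ∀ i, ∀ p ∈ (chart i).source, (chart i p).2.1 = V p
  /-- the charts cover `S`, on which `U = V = 0` -/
  cover : S ⊆ ⋃ i, (chart i).source
  mem_S_iff : ∀ i, ∀ p ∈ (chart i).source, (p ∈ S ↔ U p = 0 ∧ V p = 0)
  /-- the metric functions, smooth functions of `(UV, x_i)` -/
  G : ι → ℝ × XSpace m → ℝ
  q : ι → ℝ × XSpace m → XSpace m →L[ℝ] ℝ
  γ : ι → ℝ × XSpace m → XSpace m →L[ℝ] XSpace m →L[ℝ] ℝ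
  contDiffOn_G : ∀ i, ContDiffOn ℝ ∞ (G i) (toS '' (chart i).target)
  contDiffOn_q : ∀ i, ContDiffOn ℝ ∞ (q i) (toS '' (chart i).target)
  contDiffOn_γ : ∀ i, ContDiffOn ℝ ∞ (γ i) (toS '' (chart i).target)
  G_pos : ∀ i, ∀ y ∈ (chart i).target, 0 < G i (toS y)
  γ_symm : ∀ i, ∀ y ∈ (chart i).target, ∀ a b, γ i (toS y) a b = γ i (toS y) b a
  γ_pos : ∀ i, ∀ y ∈ (chart i).target, ∀ a, a ≠ 0 → 0 < γ i (toS y) a a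
  /-- the metric takes the Rácz–Wald form -/
  metric_eq : ∀ i, ∀ y ∈ (chart i).target, ∀ v w,
    coordBilin g.inner (chart i) y v w = rwForm (G i) (q i) (γ i) y v w
  /-- the Killing vector is `U ∂_U - V ∂_V` -/
  killing_eq : ∀ i, ∀ y ∈ (chart i).target, coordVec ξ (chart i) y = (y.1, -y.2.1, 0)

/-! ### The quotient by the Killing orbits -/

section Quotient

variable {m : ℕ}

/-- The quadrant where `U` has the sign `σ` and `V` has the sign `τ`. There `ξ` is timelike
if `στ = 1` and spacelike if `στ = -1`. -/
def quadrant (m : ℕ) (σ τ : ℤˣ) : Set (RWSpace m) :=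
  {y | 0 < ((σ : ℤ) : ℝ) * y.1 ∧ 0 < ((τ : ℤ) : ℝ) * y.2.1}

/-- The projection `π` along the orbits `t ↦ (e^t U, e^{-t} V, x)` of `ξ` in a quadrant,
in the coordinates `(z, x)` of the quotient space, where `z > 0` and `UV = ± z²`. -/
def orbitProj (y : RWSpace m) : ℝ × XSpace m := (Real.sqrt |y.1 * y.2.1|, y.2.2)

/-- The coordinate image in `{z > 0}` of the quotient `Σ` of a quadrant, for a coordinate domain
`D` in the spacetime. -/
def quotientDomain (D : Set (RWSpace m)) (σ τ : ℤˣ) : Set (ℝ × XSpace m) :=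
  orbitProj '' (D ∩ quadrant m σ τ)

/-- The coordinate image of `S`, for a coordinate domain `D` in the spacetime. -/
def surfaceDomain (D : Set (RWSpace m)) : Set (XSpace m) := {x | ((0, 0, x) : RWSpace m) ∈ D}

/-- The coordinate image in `{z = 0}` of `∂Σ ≈ S`. -/
def quotientBoundary (D : Set (RWSpace m)) : Set (ℝ × XSpace m) :=
  {c | c.1 = 0 ∧ c.2 ∈ surfaceDomain D}

/-- On the quotient of the quadrant, `B` is the two-form `λ⁻² Ω̂`, where `Ω̂` is the two-form with
`π^* Ω̂ = Ω`; since `λ` is constant along the orbits, this says `π^* B = λ⁻² Ω`. -/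
def IsRescaledTwist (g : RWSpace m → RWSpace m →L[ℝ] RWSpace m →L[ℝ] ℝ)
    (ξ : RWSpace m → RWSpace m) (D : Set (RWSpace m)) (σ τ : ℤˣ)
    (B : ℝ × XSpace m → (ℝ × XSpace m) [⋀^Fin 2]→L[ℝ] ℝ) : Prop :=
  ∀ y ∈ D ∩ quadrant m σ τ, ∀ v w : RWSpace m,
    B (orbitProj y) ![fderiv ℝ orbitProj y v, fderiv ℝ orbitProj y w]
      = (normSq g ξ y ^ 2)⁻¹ * twistContraction g ξ y v w

/-! ### The torsion one-form -/

/-- The inclusion `x ↦ (0, 0, x)` of the surface `S = {U = V = 0}`. -/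
def surfaceIncl (m : ℕ) : XSpace m →L[ℝ] RWSpace m :=
  (0 : XSpace m →L[ℝ] ℝ).prod ((0 : XSpace m →L[ℝ] ℝ).prod (ContinuousLinearMap.id ℝ (XSpace m)))

/-- `k` and `l` are smooth null normals along the surface `{U = V = 0}` (defined on the set `W` of
values of `x`) with `g(k, l) = -1`. -/
structure IsNullNormalFrame (g : RWSpace m → RWSpace m →L[ℝ] RWSpace m →L[ℝ] ℝ)
    (W : Set (XSpace m)) (k l : XSpace m → RWSpace m) : Prop where
  contDiffOn_k : ContDiffOn ℝ ∞ k W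
  contDiffOn_l : ContDiffOn ℝ ∞ l W
  normal_k : ∀ x ∈ W, ∀ X : XSpace m, g (surfaceIncl m x) (k x) (surfaceIncl m X) = 0
  normal_l : ∀ x ∈ W, ∀ X : XSpace m, g (surfaceIncl m x) (l x) (surfaceIncl m X) = 0
  null_k : ∀ x ∈ W, g (surfaceIncl m x) (k x) (k x) = 0
  null_l : ∀ x ∈ W, g (surfaceIncl m x) (l x) (l x) = 0
  normalized : ∀ x ∈ W, g (surfaceIncl m x) (k x) (l x) = -1

/-- The torsion one-form `ζ(X) = g(k, ∇_X l)` of the surface `{U = V = 0}`, for the Levi-Civita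
derivative `∇` of `g`, with `g(k, ∇_X l) = g(k, ∂_X l) + Γ_{k,Xl}`. -/
def torsion (g : RWSpace m → RWSpace m →L[ℝ] RWSpace m →L[ℝ] ℝ)
    (k l : XSpace m → RWSpace m) (x : XSpace m) : XSpace m →L[ℝ] ℝ :=
  (g (surfaceIncl m x) (k x)).comp (fderiv ℝ l x)
    + (christoffelFirst g (surfaceIncl m x) (k x) (l x)).comp (surfaceIncl m)

end Quotient

end RaczWald

end

/-! Both sides of the equivalence measure the exterior derivative of the same one-form on `S`,
namely `q(0, x) = q_a(0, x) dx^a`.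

Off the horizon `ξ♭ = (λ/2)(d log|V/U| + q)` with `λ = G UV`. Hence `ξ♭ ∧ dξ♭ = (λ²/4)(d log|V/U| +
q) ∧ dq`. The first factor takes the value `-2` on `ξ`, and `i_ξ dq = 0` because `q` depends only on
`(UV, x)`. So `Ω = -(λ²/4) dq` (`twistContraction_eq`), and `B` is `-¼ dq`: neither `G` nor `γ`
survives. On a quadrant `UV = ±z²`, so this form is smooth through `z = 0`; there `d(UV) = ±2z dz`
vanishes and only `-¼ d(q(0, x))` remains (`isRescaledTwist_iff`,
`rescaledTwist_boundary_eq_zero_iff`).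

Null normals of `S` are multiples of `∂_U` and `∂_V`. If `b` is the nonzero component of `ℓ`, then
`ζ = -½ d log(G b²) ∓ ½ q(0, x)`, the sign depending on which direction `ℓ` has. A change of frame
within one direction only alters the exact part, so `dζ = ∓½ d(q(0, x))` (`torsion_eq`,
`dOne_torsion`). -/

namespace RaczWald

/-! ### Exterior derivatives of one-forms -/

section OneForms

variable {E : Type*} [NormedAddCommGroup E] [NormedSpace ℝ E]

theorem fderiv_apply_const {F : Type*} [NormedAddCommGroup F] [NormedSpace ℝ F]
    {α : E → F →L[ℝ] ℝ} {y : E} (h : DifferentiableAt ℝ α y) (v : E) (w : F) :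
    fderiv ℝ α y v w = fderiv ℝ (fun y' => α y' w) y v := by
  rw [fderiv_clm_apply h (differentiableAt_const w)]
  simp

theorem dOne_apply {α : E → E →L[ℝ] ℝ} {y : E} (h : DifferentiableAt ℝ α y) (v w : E) :
    dOne α y ![v, w] = fderiv ℝ α y v w - fderiv ℝ α y w v := by
  have h' : DifferentiableAt ℝ
      (fun y' => ContinuousAlternatingMap.ofSubsingleton ℝ E ℝ (0 : Fin 1) (α y')) y :=
    (ContinuousAlternatingMap.ofSubsingletonLIE (𝕜 := ℝ) (E := E) (F := ℝ)
      (0 : Fin 1)).toContinuousLinearEquiv.differentiableAt.comp y h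
  rw [dOne, extDeriv_apply h', Fin.sum_univ_two, fderiv_apply_const h, fderiv_apply_const h]
  simp [Fin.removeNth, sub_eq_add_neg]

theorem dOne_congr {α β : E → E →L[ℝ] ℝ} {y : E} (h : α =ᶠ[𝓝 y] β) : dOne α y = dOne β y := by
  apply Filter.EventuallyEq.extDeriv_eq
  filter_upwards [h] with z hz
  rw [hz]

/-- A two-form is determined by its values on pairs of vectors. -/
theorem twoForm_ext {B C : E [⋀^Fin 2]→L[ℝ] ℝ} (h : ∀ v w, B ![v, w] = C ![v, w]) : B = C := by
  ext v
  have hv : v = ![v 0, v 1] := by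
    ext i
    fin_cases i <;> rfl
  rw [hv]
  exact h _ _

theorem contDiffOn_dOne {α : E → E →L[ℝ] ℝ} {s : Set E} (hs : IsOpen s)
    (h : ContDiffOn ℝ ∞ α s) : ContDiffOn ℝ ∞ (dOne α) s := by
  have h' : ContDiffOn ℝ ∞
      (fun y' => ContinuousAlternatingMap.ofSubsingleton ℝ E ℝ (0 : Fin 1) (α y')) s :=
    (ContinuousAlternatingMap.ofSubsingletonLIE (𝕜 := ℝ) (E := E) (F := ℝ)
      (0 : Fin 1)).toContinuousLinearEquiv.contDiff.comp_contDiffOn h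
  exact (ContinuousAlternatingMap.alternatizeUncurryFinCLM ℝ E ℝ).contDiff.comp_contDiffOn
    (h'.fderiv_of_isOpen hs (m := ∞) (by exact_mod_cast le_rfl))

/-- Adding an exact form to a multiple of a one-form. -/
theorem dOne_fderiv_add_smul {f : E → ℝ} {α : E → E →L[ℝ] ℝ} {y : E} (c : ℝ)
    (hf : ContDiffAt ℝ ∞ f y) (h : DifferentiableAt ℝ α y) :
    dOne (fun z => fderiv ℝ f z + c • α z) y = c • dOne α y := by
  have hf' : DifferentiableAt ℝ (fderiv ℝ f) y :=
    (hf.fderiv_right (m := 1) (by norm_num; exact ENat.LEInfty.out)).differentiableAt one_ne_zero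
  -- Symmetry of the second derivative is what makes `d(df) = 0`.
  have hsymm : IsSymmSndFDerivAt ℝ f y := hf.isSymmSndFDerivAt (by simpa using ENat.LEInfty.out)
  refine twoForm_ext fun v w => ?_
  rw [dOne_apply (α := fun z => fderiv ℝ f z + c • α z) (hf'.add (h.const_smul c)),
    ContinuousAlternatingMap.smul_apply, dOne_apply h]
  have h2 : fderiv ℝ (fun z => fderiv ℝ f z + c • α z) y
      = fderiv ℝ (fderiv ℝ f) y + c • fderiv ℝ α y :=
    (hf'.hasFDerivAt.add (h.hasFDerivAt.const_smul c)).fderiv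
  rw [h2]
  simp only [add_apply, smul_apply, smul_eq_mul,
    hsymm.eq v w]
  ring

end OneForms

/-! ### The twist of a metric in Rácz–Wald form -/

section LocalForm

variable {m : ℕ}

/-- The coordinate data of a Rácz–Wald chart: on the open set `D` the metric `g` and the Killing
vector `ξ` take the Rácz–Wald form. -/
structure IsRaczWald (g : RWSpace m → RWSpace m →L[ℝ] RWSpace m →L[ℝ] ℝ)
    (ξ : RWSpace m → RWSpace m) (D : Set (RWSpace m)) (G : ℝ × XSpace m → ℝ)
    (q : ℝ × XSpace m → XSpace m →L[ℝ] ℝ)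
    (γ : ℝ × XSpace m → XSpace m →L[ℝ] XSpace m →L[ℝ] ℝ) : Prop where
  isOpen : IsOpen D
  contDiffOn_G : ContDiffOn ℝ ∞ G (toS '' D)
  contDiffOn_q : ContDiffOn ℝ ∞ q (toS '' D)
  contDiffOn_γ : ContDiffOn ℝ ∞ γ (toS '' D)
  G_pos : ∀ y ∈ D, 0 < G (toS y)
  γ_pos : ∀ y ∈ D, ∀ a, a ≠ 0 → 0 < γ (toS y) a a
  metric_eq : ∀ y ∈ D, ∀ v w, g y v w = rwForm G q γ y v w
  killing_eq : ∀ y ∈ D, ξ y = (y.1, -y.2.1, 0)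

/-- The derivative of `(U, V, x) ↦ (UV, x)`. -/
noncomputable def toSDeriv (y : RWSpace m) : RWSpace m →L[ℝ] ℝ × XSpace m :=
  (y.1 • (ContinuousLinearMap.fst ℝ ℝ (XSpace m)).comp (ContinuousLinearMap.snd ℝ ℝ (ℝ × XSpace m))
    + y.2.1 • ContinuousLinearMap.fst ℝ ℝ (ℝ × XSpace m)).prod
  ((ContinuousLinearMap.snd ℝ ℝ (XSpace m)).comp (ContinuousLinearMap.snd ℝ ℝ (ℝ × XSpace m)))

theorem toSDeriv_apply (y v : RWSpace m) :
    toSDeriv y v = (y.1 * v.2.1 + y.2.1 * v.1, v.2.2) := rfl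

theorem hasFDerivAt_toS (y : RWSpace m) : HasFDerivAt toS (toSDeriv y) y := by
  have h1 : HasFDerivAt (fun y : RWSpace m => y.1) (ContinuousLinearMap.fst ℝ ℝ (ℝ × XSpace m)) y :=
    hasFDerivAt_fst
  have h2 : HasFDerivAt (fun y : RWSpace m => y.2.1) ((ContinuousLinearMap.fst ℝ ℝ (XSpace m)).comp
      (ContinuousLinearMap.snd ℝ ℝ (ℝ × XSpace m))) y :=
    hasFDerivAt_fst.comp y hasFDerivAt_snd
  have h3 : HasFDerivAt (fun y : RWSpace m => y.2.2) ((ContinuousLinearMap.snd ℝ ℝ (XSpace m)).comp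
      (ContinuousLinearMap.snd ℝ ℝ (ℝ × XSpace m))) y :=
    hasFDerivAt_snd.comp y hasFDerivAt_snd
  exact (h1.mul h2).prodMk h3

theorem contDiff_toS : ContDiff ℝ ∞ (toS : RWSpace m → ℝ × XSpace m) := by
  unfold toS
  fun_prop

/-- The map `(U, V, x) ↦ (UV, x)` has continuous local sections through every point, so it is
open. -/
theorem isOpenMap_toS : IsOpenMap (toS : RWSpace m → ℝ × XSpace m) := by
  rw [isOpenMap_iff_nhds_le]
  rintro ⟨u, v, x⟩
  suffices h : ∃ f : ℝ × XSpace m → RWSpace m, ContinuousAt f (toS (u, v, x)) ∧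
      f (toS (u, v, x)) = (u, v, x) ∧ ∀ c, toS (f c) = c by
    obtain ⟨f, hf, hfy, hs⟩ := h
    have hf' : Filter.Tendsto f (𝓝 (toS (u, v, x))) (𝓝 (u, v, x)) := by
      simpa only [ContinuousAt, hfy] using hf
    calc 𝓝 (toS (u, v, x)) = Filter.map toS (Filter.map f (𝓝 (toS (u, v, x)))) := by
          rw [Filter.map_map, show (toS ∘ f) = id from funext hs, Filter.map_id]
      _ ≤ _ := Filter.map_mono hf'
  by_cases hu : u = 0
  · by_cases hv : v = 0
    · subst hu hv
      -- Over `S` the product `UV` is not a submersion, so a smooth section is not available;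
      -- splitting `s` as `(sign s √|s|) · √|s|` is still continuous at `0`.
      refine ⟨fun c => (SignType.sign c.1 * Real.sqrt |c.1|, Real.sqrt |c.1|, c.2), ?_, ?_, ?_⟩
      · have h0 : Filter.Tendsto (fun c : ℝ × XSpace m => Real.sqrt |c.1|)
            (𝓝 (toS (0, 0, x))) (𝓝 0) := by
          have : Continuous (fun c : ℝ × XSpace m => Real.sqrt |c.1|) := by fun_prop
          simpa [toS] using this.tendsto (toS (0, 0, x))
        have h1 : Filter.Tendsto (fun c : ℝ × XSpace m => (SignType.sign c.1 : ℝ) * Real.sqrt |c.1|)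
            (𝓝 (toS (0, 0, x))) (𝓝 0) := by
          refine squeeze_zero_norm (fun c => ?_) h0
          rw [norm_mul, Real.norm_eq_abs, Real.norm_eq_abs, abs_of_nonneg (Real.sqrt_nonneg _)]
          refine mul_le_of_le_one_left (Real.sqrt_nonneg _) ?_
          cases SignType.sign c.1 <;> simp
        have h2 : Filter.Tendsto (fun c : ℝ × XSpace m => c.2) (𝓝 (toS (0, 0, x))) (𝓝 x) :=
          continuous_snd.tendsto _
        have := h1.prodMk_nhds (h0.prodMk_nhds h2)
        simpa [ContinuousAt, toS] using this
      · simp [toS]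
      · intro c
        simp [toS, mul_assoc]
    · refine ⟨fun c => (c.1 / v, v, c.2), ?_, ?_, ?_⟩
      · fun_prop (disch := assumption)
      · simp [toS, hv]
      · intro c
        simp [toS, hv]
  · refine ⟨fun c => (u, c.1 / u, c.2), ?_, ?_, ?_⟩
    · fun_prop (disch := assumption)
    · simp [toS, hu]
    · intro c
      simp [toS, mul_div_cancel₀, hu]

namespace IsRaczWald

variable {g : RWSpace m → RWSpace m →L[ℝ] RWSpace m →L[ℝ] ℝ}
  {ξ : RWSpace m → RWSpace m} {D : Set (RWSpace m)} {G : ℝ × XSpace m → ℝ}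
  {q : ℝ × XSpace m → XSpace m →L[ℝ] ℝ}
  {γ : ℝ × XSpace m → XSpace m →L[ℝ] XSpace m →L[ℝ] ℝ}

/-- The metric functions are only assumed smooth on `toS '' D`. Openness of this set gives them
genuine derivatives at every point, including those over `S`. -/
theorem isOpen_image (h : IsRaczWald g ξ D G q γ) : IsOpen (toS '' D) :=
  isOpenMap_toS D h.isOpen

theorem hasFDerivAt_G (h : IsRaczWald g ξ D G q γ) {y : RWSpace m} (hy : y ∈ D) :
    HasFDerivAt (fun z => G (toS z)) ((fderiv ℝ G (toS y)).comp (toSDeriv y)) y :=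
  ((h.contDiffOn_G.contDiffAt (h.isOpen_image.mem_nhds ⟨y, hy, rfl⟩)).differentiableAt
    (by simp)).hasFDerivAt.comp y (hasFDerivAt_toS y)

theorem hasFDerivAt_q (h : IsRaczWald g ξ D G q γ) {y : RWSpace m} (hy : y ∈ D) :
    HasFDerivAt (fun z => q (toS z)) ((fderiv ℝ q (toS y)).comp (toSDeriv y)) y :=
  ((h.contDiffOn_q.contDiffAt (h.isOpen_image.mem_nhds ⟨y, hy, rfl⟩)).differentiableAt
    (by simp)).hasFDerivAt.comp y (hasFDerivAt_toS y)

theorem hasFDerivAt_q_apply (h : IsRaczWald g ξ D G q γ) {y : RWSpace m} (hy : y ∈ D)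
    (a : XSpace m) :
    HasFDerivAt (fun z => q (toS z) a) (((fderiv ℝ q (toS y)).comp (toSDeriv y)).flip a) y := by
  have := (h.hasFDerivAt_q hy).clm_apply (hasFDerivAt_const a y)
  simpa using this

theorem contDiffOn_metric (h : IsRaczWald g ξ D G q γ) : ContDiffOn ℝ ∞ g D := by
  have hm : MapsTo (toS : RWSpace m → ℝ × XSpace m) D (toS '' D) := mapsTo_image _ _
  have hG := h.contDiffOn_G.comp contDiff_toS.contDiffOn hm
  have hq := h.contDiffOn_q.comp contDiff_toS.contDiffOn hm
  have hγ := h.contDiffOn_γ.comp contDiff_toS.contDiffOn hm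
  simp only [Function.comp_def] at hG hq hγ
  refine contDiffOn_clm_apply.2 fun v => contDiffOn_clm_apply.2 fun w => ?_
  refine ContDiffOn.congr ?_ fun y hy => h.metric_eq y hy v w
  unfold rwForm
  have hV : ContDiffOn ℝ ∞ (fun y : RWSpace m => y.2.1) D := by fun_prop
  have hqc : ∀ a, ContDiffOn ℝ ∞ (fun y => q (toS y) a) D := fun a =>
    hq.clm_apply contDiffOn_const
  exact ((hG.div_const 2).mul ((contDiffOn_const.mul (contDiffOn_const.add (hV.mul (hqc _)))).add
    (contDiffOn_const.mul (contDiffOn_const.add (hV.mul (hqc _)))))).add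
    ((hγ.clm_apply contDiffOn_const).clm_apply contDiffOn_const)

theorem differentiableAt_metric (h : IsRaczWald g ξ D G q γ) {y : RWSpace m} (hy : y ∈ D) :
    DifferentiableAt ℝ g y :=
  (h.contDiffOn_metric.contDiffAt (h.isOpen.mem_nhds hy)).differentiableAt (by simp)

theorem flat_apply (h : IsRaczWald g ξ D G q γ) {y : RWSpace m} (hy : y ∈ D) (w : RWSpace m) :
    flat g ξ y w
      = G (toS y) / 2 * (y.1 * w.2.1 - y.2.1 * w.1 + y.1 * y.2.1 * q (toS y) w.2.2) := by
  rw [flat, h.metric_eq y hy, h.killing_eq y hy, rwForm]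
  simp only [map_zero, zero_apply]
  ring

theorem normSq_eq (h : IsRaczWald g ξ D G q γ) {y : RWSpace m} (hy : y ∈ D) :
    normSq g ξ y = G (toS y) * (y.1 * y.2.1) := by
  have := h.flat_apply hy (ξ y)
  rw [flat] at this
  rw [normSq, this, h.killing_eq y hy]
  simp
  ring

theorem differentiableAt_flat (h : IsRaczWald g ξ D G q γ) {y : RWSpace m} (hy : y ∈ D) :
    DifferentiableAt ℝ (flat g ξ) y := by
  have hξ : DifferentiableAt ℝ ξ y := by
    have h1 : DifferentiableAt ℝ (fun y : RWSpace m => ((y.1, -y.2.1, 0) : RWSpace m)) y := by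
      fun_prop
    refine h1.congr_of_eventuallyEq ?_
    filter_upwards [h.isOpen.mem_nhds hy] with z hz using h.killing_eq z hz
  exact (h.differentiableAt_metric hy).clm_apply hξ

theorem fderiv_flat_apply (h : IsRaczWald g ξ D G q γ) {y : RWSpace m} (hy : y ∈ D)
    (v w : RWSpace m) :
    fderiv ℝ (flat g ξ) y v w
      = fderiv ℝ G (toS y) (toSDeriv y v) / 2
          * (y.1 * w.2.1 - y.2.1 * w.1 + y.1 * y.2.1 * q (toS y) w.2.2)
        + G (toS y) / 2 * (v.1 * w.2.1 - v.2.1 * w.1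
          + (y.1 * v.2.1 + y.2.1 * v.1) * q (toS y) w.2.2
          + y.1 * y.2.1 * fderiv ℝ q (toS y) (toSDeriv y v) w.2.2) := by
  have h1 : HasFDerivAt (fun y : RWSpace m => y.1) (ContinuousLinearMap.fst ℝ ℝ (ℝ × XSpace m)) y :=
    hasFDerivAt_fst
  have h2 : HasFDerivAt (fun y : RWSpace m => y.2.1) ((ContinuousLinearMap.fst ℝ ℝ (XSpace m)).comp
      (ContinuousLinearMap.snd ℝ ℝ (ℝ × XSpace m))) y :=
    hasFDerivAt_fst.comp y hasFDerivAt_snd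
  have h3 := ((h.hasFDerivAt_G hy).mul_const (2 : ℝ)⁻¹).mul
    (((h1.mul_const w.2.1).sub (h2.mul_const w.1)).add
      ((h1.mul h2).mul (h.hasFDerivAt_q_apply hy w.2.2)))
  have h4 : (fun z => flat g ξ z w) =ᶠ[𝓝 y] fun z => G (toS z) * (2 : ℝ)⁻¹ *
      (z.1 * w.2.1 - z.2.1 * w.1 + z.1 * z.2.1 * q (toS z) w.2.2) := by
    filter_upwards [h.isOpen.mem_nhds hy] with z hz
    rw [h.flat_apply hz, div_eq_mul_inv]
  rw [fderiv_apply_const (h.differentiableAt_flat hy), h4.fderiv_eq]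
  erw [h3.fderiv]
  simp
  ring

/-- The twist of a Rácz–Wald metric is `Ω = - (λ² / 4) dq`. -/
theorem twistContraction_eq (h : IsRaczWald g ξ D G q γ) {y : RWSpace m} (hy : y ∈ D)
    (v w : RWSpace m) :
    twistContraction g ξ y v w = -(1 / 4) * normSq g ξ y ^ 2
      * (fderiv ℝ q (toS y) (toSDeriv y v) w.2.2 - fderiv ℝ q (toS y) (toSDeriv y w) v.2.2) := by
  have hd := h.differentiableAt_flat hy
  -- The flow of `ξ` preserves `UV` and `x`, so every function of `(UV, x)` has zero derivative
  -- along `ξ`.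
  have h0 : toSDeriv y (ξ y) = 0 := by
    rw [h.killing_eq y hy, toSDeriv_apply]
    ext <;> simp
    ring
  rw [twistContraction, twist, dOne_apply hd, dOne_apply hd, dOne_apply hd, h.normSq_eq hy]
  simp only [h.fderiv_flat_apply hy, h.flat_apply hy, h0]
  simp only [h.killing_eq y hy, map_zero, zero_apply]
  ring

end IsRaczWald

end LocalForm
-- The rescaled twist on the quotient and its boundary values
section Quotient

variable {m : ℕ}

/-- The map `(z, x) ↦ (ε z², x)`, which expresses `(UV, x)` on the quotient of a quadrant where `UV`
has the sign `ε`. -/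
def squareMap (m : ℕ) (ε : ℝ) (c : ℝ × XSpace m) : ℝ × XSpace m := (ε * c.1 ^ 2, c.2)

/-- The derivative of `(z, x) ↦ (ε z², x)`. -/
noncomputable def squareMapDeriv (ε : ℝ) (c : ℝ × XSpace m) : ℝ × XSpace m →L[ℝ] ℝ × XSpace m :=
  ((ε * (2 * c.1)) • ContinuousLinearMap.fst ℝ ℝ (XSpace m)).prod
    (ContinuousLinearMap.snd ℝ ℝ (XSpace m))

theorem squareMapDeriv_apply (ε : ℝ) (c a : ℝ × XSpace m) :
    squareMapDeriv ε c a = (ε * (2 * c.1) * a.1, a.2) := rfl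

theorem hasFDerivAt_squareMap (ε : ℝ) (c : ℝ × XSpace m) :
    HasFDerivAt (squareMap m ε) (squareMapDeriv ε c) c := by
  have h1 : HasFDerivAt (fun c : ℝ × XSpace m => c.1) (ContinuousLinearMap.fst ℝ ℝ (XSpace m)) c :=
    hasFDerivAt_fst
  have h2 : HasFDerivAt (fun c : ℝ × XSpace m => c.2) (ContinuousLinearMap.snd ℝ ℝ (XSpace m)) c :=
    hasFDerivAt_snd
  refine HasFDerivAt.congr_fderiv (((h1.pow 2).const_mul ε).prodMk h2) ?_
  refine ContinuousLinearMap.ext fun a => ?_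
  simp [squareMapDeriv_apply, mul_assoc]

theorem contDiff_squareMap (ε : ℝ) : ContDiff ℝ ∞ (squareMap m ε) := by
  unfold squareMap
  fun_prop

/-- The sign of `UV` on a quadrant. -/
def quadrantSign (σ τ : ℤˣ) : ℝ := ((σ : ℤ) : ℝ) * ((τ : ℤ) : ℝ)

theorem quadrantSign_ne_zero (σ τ : ℤˣ) : quadrantSign σ τ ≠ 0 := by
  rcases Int.units_eq_one_or σ with rfl | rfl <;> rcases Int.units_eq_one_or τ with rfl | rfl <;>
    simp [quadrantSign]

theorem isOpen_quadrant (σ τ : ℤˣ) : IsOpen (quadrant m σ τ) := by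
  have h1 : Continuous fun y : RWSpace m => ((σ : ℤ) : ℝ) * y.1 := by fun_prop
  have h2 : Continuous fun y : RWSpace m => ((τ : ℤ) : ℝ) * y.2.1 := by fun_prop
  exact (isOpen_lt continuous_const h1).inter (isOpen_lt continuous_const h2)

theorem ne_zero_of_mem_quadrant {σ τ : ℤˣ} {y : RWSpace m} (hy : y ∈ quadrant m σ τ) :
    y.1 ≠ 0 ∧ y.2.1 ≠ 0 :=
  ⟨right_ne_zero_of_mul hy.1.ne', right_ne_zero_of_mul hy.2.ne'⟩

theorem squareMap_orbitProj {σ τ : ℤˣ} {y : RWSpace m} (hy : y ∈ quadrant m σ τ) :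
    squareMap m (quadrantSign σ τ) (orbitProj y) = toS y := by
  have h : quadrantSign σ τ * |y.1 * y.2.1| = y.1 * y.2.1 := by
    obtain ⟨h1, h2⟩ := hy
    rw [abs_mul, quadrantSign]
    rcases Int.units_eq_one_or σ with rfl | rfl <;>
      rcases Int.units_eq_one_or τ with rfl | rfl <;> simp at h1 h2 ⊢ <;>
      simp [abs_of_pos, abs_of_neg, h1, h2]
  simp only [squareMap, orbitProj, toS, Real.sq_sqrt (abs_nonneg _), h]

theorem differentiableAt_orbitProj {σ τ : ℤˣ} {y : RWSpace m} (hy : y ∈ quadrant m σ τ) :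
    DifferentiableAt ℝ orbitProj y := by
  have h := ne_zero_of_mem_quadrant hy
  have h0 : y.1 * y.2.1 ≠ 0 := mul_ne_zero h.1 h.2
  have h1 : DifferentiableAt ℝ (fun y : RWSpace m => y.1 * y.2.1) y := by fun_prop
  exact ((h1.abs h0).sqrt (abs_ne_zero.2 h0)).prodMk (by fun_prop)

/-- The chain rule for `toS = squareMap ∘ orbitProj`; it avoids computing the derivative of the
square root in `orbitProj`. -/
theorem squareMapDeriv_fderiv_orbitProj {σ τ : ℤˣ} {y : RWSpace m} (hy : y ∈ quadrant m σ τ)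
    (v : RWSpace m) :
    squareMapDeriv (quadrantSign σ τ) (orbitProj y) (fderiv ℝ orbitProj y v) = toSDeriv y v := by
  have h1 := (hasFDerivAt_squareMap (quadrantSign σ τ) (orbitProj y)).comp y
    (differentiableAt_orbitProj hy).hasFDerivAt
  have h2 : toS =ᶠ[𝓝 y] squareMap m (quadrantSign σ τ) ∘ orbitProj := by
    filter_upwards [(isOpen_quadrant σ τ).mem_nhds hy] with z hz
    exact (squareMap_orbitProj hz).symm
  rw [← (h1.congr_of_eventuallyEq h2).unique (hasFDerivAt_toS y)]
  rfl

theorem orbitProj_fst_ne_zero {σ τ : ℤˣ} {y : RWSpace m} (hy : y ∈ quadrant m σ τ) :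
    (orbitProj y).1 ≠ 0 := by
  have h := ne_zero_of_mem_quadrant hy
  exact (Real.sqrt_pos.2 (abs_pos.2 (mul_ne_zero h.1 h.2))).ne'

/-- A form on the quotient is therefore determined by its pullback, which gives uniqueness of `B` on
the quotient. -/
theorem fderiv_orbitProj_surjective {σ τ : ℤˣ} {y : RWSpace m} (hy : y ∈ quadrant m σ τ)
    (a : ℝ × XSpace m) : ∃ v, fderiv ℝ orbitProj y v = a := by
  have hε := quadrantSign_ne_zero σ τ
  have hz := orbitProj_fst_ne_zero hy
  have hU := (ne_zero_of_mem_quadrant hy).1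
  -- The lift keeps `U` fixed; its `V` component solves `U dV = d(ε z²) = 2 ε z dz`.
  refine ⟨(0, quadrantSign σ τ * (2 * (orbitProj y).1) * a.1 / y.1, a.2), ?_⟩
  have h := squareMapDeriv_fderiv_orbitProj hy
    (0, quadrantSign σ τ * (2 * (orbitProj y).1) * a.1 / y.1, a.2)
  rw [squareMapDeriv_apply, toSDeriv_apply, Prod.mk.injEq] at h
  refine Prod.ext ?_ h.2
  refine mul_left_cancel₀ (mul_ne_zero hε (mul_ne_zero two_ne_zero hz)) (h.1.trans ?_)
  field_simp
  ring

/-- The pullback to the quotient space, in the coordinates `(z, x)`, of the one-form `q_a dx^a`. -/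
noncomputable def quotientForm (ε : ℝ) (q : ℝ × XSpace m → XSpace m →L[ℝ] ℝ) (c : ℝ × XSpace m) :
    ℝ × XSpace m →L[ℝ] ℝ :=
  (q (squareMap m ε c)).comp (ContinuousLinearMap.snd ℝ ℝ (XSpace m))

/-- The two-form `- ¼ dq` on the quotient space. -/
noncomputable def rescaledTwist (ε : ℝ) (q : ℝ × XSpace m → XSpace m →L[ℝ] ℝ) (c : ℝ × XSpace m) :
    (ℝ × XSpace m) [⋀^Fin 2]→L[ℝ] ℝ :=
  (-(1 / 4) : ℝ) • dOne (quotientForm ε q) c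

theorem quotientDomain_subset (D : Set (RWSpace m)) (σ τ : ℤˣ) :
    quotientDomain D σ τ ⊆ squareMap m (quadrantSign σ τ) ⁻¹' (toS '' D) := by
  rintro _ ⟨y, hy, rfl⟩
  exact ⟨y, hy.1, (squareMap_orbitProj hy.2).symm⟩

theorem quotientBoundary_subset (D : Set (RWSpace m)) (ε : ℝ) :
    quotientBoundary D ⊆ squareMap m ε ⁻¹' (toS '' D) := by
  rintro ⟨z, x⟩ ⟨hz, hx⟩
  simp only at hz
  subst hz
  exact ⟨(0, 0, x), hx, by simp [toS, squareMap]⟩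

/-- The curve `t ↦ (σt, τt, x)` stays in the quadrant and tends to the point of `S` as `t ↓ 0`. This
density makes the continuous extension of `B` to the boundary unique. -/
theorem quotientBoundary_subset_closure {D : Set (RWSpace m)} (hD : IsOpen D) (σ τ : ℤˣ) :
    quotientBoundary D ⊆ closure (quotientDomain D σ τ) := by
  rintro ⟨z, x⟩ ⟨hz, hx⟩
  simp only at hz
  subst hz
  let f : ℝ → RWSpace m := fun t => (((σ : ℤ) : ℝ) * t, ((τ : ℤ) : ℝ) * t, x)
  have hf : Continuous f := by fun_prop
  have hf0 : f 0 = (0, 0, x) := by simp [f]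
  have h1 : ∀ᶠ t in 𝓝[>] (0 : ℝ), f t ∈ D :=
    (hf.continuousAt.eventually_mem (hD.mem_nhds (by rw [hf0]; exact hx))).filter_mono
      nhdsWithin_le_nhds
  have hp : Continuous (orbitProj : RWSpace m → ℝ × XSpace m) := by
    unfold orbitProj
    fun_prop
  have h2 : Filter.Tendsto (fun t => orbitProj (f t)) (𝓝[>] (0 : ℝ)) (𝓝 ((0 : ℝ), x)) := by
    have h3 := (hp.comp hf).tendsto 0
    simp only [Function.comp_def, hf0] at h3
    have h4 : orbitProj ((0, 0, x) : RWSpace m) = (0, x) := by simp [orbitProj]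
    rw [h4] at h3
    exact h3.mono_left nhdsWithin_le_nhds
  refine mem_closure_of_tendsto h2 ?_
  filter_upwards [h1, self_mem_nhdsWithin] with t ht ht0
  refine ⟨f t, ⟨ht, ?_⟩, rfl⟩
  have ht0' : (0 : ℝ) < t := ht0
  rcases Int.units_eq_one_or σ with rfl | rfl <;>
    rcases Int.units_eq_one_or τ with rfl | rfl <;> simp [quadrant, f, ht0']

namespace IsRaczWald

variable {g : RWSpace m → RWSpace m →L[ℝ] RWSpace m →L[ℝ] ℝ}
  {ξ : RWSpace m → RWSpace m} {D : Set (RWSpace m)} {G : ℝ × XSpace m → ℝ}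
  {q : ℝ × XSpace m → XSpace m →L[ℝ] ℝ}
  {γ : ℝ × XSpace m → XSpace m →L[ℝ] XSpace m →L[ℝ] ℝ}

theorem isOpen_preimage (h : IsRaczWald g ξ D G q γ) (ε : ℝ) :
    IsOpen (squareMap m ε ⁻¹' (toS '' D)) :=
  h.isOpen_image.preimage (contDiff_squareMap ε).continuous

theorem contDiffOn_quotientForm (h : IsRaczWald g ξ D G q γ) (ε : ℝ) :
    ContDiffOn ℝ ∞ (quotientForm ε q) (squareMap m ε ⁻¹' (toS '' D)) :=
  (h.contDiffOn_q.comp (contDiff_squareMap ε).contDiffOn (mapsTo_preimage _ _)).clm_comp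
    contDiffOn_const

/-- The set is open and contains the quotient together with its boundary: `ε z²` is smooth across `z
= 0`, so smoothness up to the boundary is a restriction of smoothness on a full neighbourhood. -/
theorem contDiffOn_rescaledTwist (h : IsRaczWald g ξ D G q γ) (ε : ℝ) :
    ContDiffOn ℝ ∞ (rescaledTwist ε q) (squareMap m ε ⁻¹' (toS '' D)) :=
  (contDiffOn_dOne (h.isOpen_preimage ε) (h.contDiffOn_quotientForm ε)).const_smul _

theorem rescaledTwist_apply (h : IsRaczWald g ξ D G q γ) (ε : ℝ) {c : ℝ × XSpace m}
    (hc : squareMap m ε c ∈ toS '' D) (a b : ℝ × XSpace m) :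
    rescaledTwist ε q c ![a, b]
      = -(1 / 4) * (fderiv ℝ q (squareMap m ε c) (squareMapDeriv ε c a) b.2
        - fderiv ℝ q (squareMap m ε c) (squareMapDeriv ε c b) a.2) := by
  have hd : DifferentiableAt ℝ (quotientForm ε q) c :=
    ((h.contDiffOn_quotientForm ε).contDiffAt ((h.isOpen_preimage ε).mem_nhds hc)).differentiableAt
      (by simp)
  have hq := ((h.contDiffOn_q.contDiffAt (h.isOpen_image.mem_nhds hc)).differentiableAt
    (by simp)).hasFDerivAt.comp c (hasFDerivAt_squareMap ε c)
  have hv : ∀ a b, fderiv ℝ (quotientForm ε q) c a b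
      = fderiv ℝ q (squareMap m ε c) (squareMapDeriv ε c a) b.2 := by
    intro a b
    have h1 : HasFDerivAt (fun c => quotientForm ε q c b) _ c :=
      hq.clm_apply (hasFDerivAt_const b.2 c)
    rw [fderiv_apply_const hd, h1.fderiv]
    simp
  rw [rescaledTwist, ContinuousAlternatingMap.smul_apply, dOne_apply hd, hv, hv, smul_eq_mul]

/-- Since `λ ≠ 0` on a quadrant, the factor `λ²` in `Ω = -(λ²/4) dq` cancels, leaving the pullback
of `-¼ dq`. -/
theorem isRescaledTwist_iff (h : IsRaczWald g ξ D G q γ) {σ τ : ℤˣ}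
    {B : ℝ × XSpace m → (ℝ × XSpace m) [⋀^Fin 2]→L[ℝ] ℝ} :
    IsRescaledTwist g ξ D σ τ B ↔
      EqOn B (rescaledTwist (quadrantSign σ τ) q) (quotientDomain D σ τ) := by
  have key : ∀ y ∈ D ∩ quadrant m σ τ, ∀ v w : RWSpace m,
      rescaledTwist (quadrantSign σ τ) q (orbitProj y)
          ![fderiv ℝ orbitProj y v, fderiv ℝ orbitProj y w]
        = (normSq g ξ y ^ 2)⁻¹ * twistContraction g ξ y v w := by
    rintro y ⟨hy, hyq⟩ v w
    have hs : ∀ v : RWSpace m, (fderiv ℝ orbitProj y v).2 = v.2.2 := by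
      intro v
      have := squareMapDeriv_fderiv_orbitProj hyq v
      rw [squareMapDeriv_apply, toSDeriv_apply] at this
      exact (Prod.mk.inj this).2
    have hn : normSq g ξ y ≠ 0 := by
      have := ne_zero_of_mem_quadrant hyq
      rw [h.normSq_eq hy]
      exact mul_ne_zero (h.G_pos y hy).ne' (mul_ne_zero this.1 this.2)
    have hm : squareMap m (quadrantSign σ τ) (orbitProj y) ∈ toS '' D :=
      ⟨y, hy, (squareMap_orbitProj hyq).symm⟩
    rw [h.rescaledTwist_apply _ hm, squareMapDeriv_fderiv_orbitProj hyq,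
      squareMapDeriv_fderiv_orbitProj hyq, squareMap_orbitProj hyq, hs, hs,
      h.twistContraction_eq hy]
    field_simp
  constructor
  · rintro hB _ ⟨y, hy, rfl⟩
    refine twoForm_ext fun a b => ?_
    obtain ⟨v, rfl⟩ := fderiv_orbitProj_surjective hy.2 a
    obtain ⟨w, rfl⟩ := fderiv_orbitProj_surjective hy.2 b
    rw [hB y hy, key y hy]
  · intro hB y hy v w
    rw [hB ⟨y, hy, rfl⟩, key y hy]

theorem mem_image_surface {x : XSpace m} (hx : x ∈ surfaceDomain D) :
    ((0, x) : ℝ × XSpace m) ∈ toS '' D :=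
  ⟨(0, 0, x), hx, by simp [toS]⟩

theorem hasFDerivAt_q_surface (h : IsRaczWald g ξ D G q γ) {x : XSpace m}
    (hx : x ∈ surfaceDomain D) :
    HasFDerivAt (fun x : XSpace m => q (0, x))
      ((fderiv ℝ q (0, x)).comp (ContinuousLinearMap.inr ℝ ℝ (XSpace m))) x :=
  ((h.contDiffOn_q.contDiffAt (h.isOpen_image.mem_nhds
    (mem_image_surface hx))).differentiableAt (by simp)).hasFDerivAt.comp x
    (hasFDerivAt_prodMk_right (0 : ℝ) x)

/-- The derivative of `ε z²` vanishes at `z = 0`, so all components involving `dz` vanish there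
automatically and only those tangent to `S` carry a condition. -/
theorem rescaledTwist_boundary_eq_zero_iff (h : IsRaczWald g ξ D G q γ) (ε : ℝ) {x : XSpace m}
    (hx : x ∈ surfaceDomain D) :
    rescaledTwist ε q (0, x) = 0 ↔ dOne (fun x : XSpace m => q (0, x)) x = 0 := by
  have h0 : squareMap m ε (0, x) = (0, x) := by simp [squareMap]
  have hm : squareMap m ε (0, x) ∈ toS '' D := by
    rw [h0]
    exact mem_image_surface hx
  have hq := h.hasFDerivAt_q_surface hx
  have key : ∀ a b : ℝ × XSpace m, rescaledTwist ε q (0, x) ![a, b]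
      = -(1 / 4) * dOne (fun x : XSpace m => q (0, x)) x ![a.2, b.2] := by
    intro a b
    rw [h.rescaledTwist_apply ε hm, dOne_apply hq.differentiableAt, hq.fderiv, h0]
    simp [squareMapDeriv_apply]
  constructor
  · intro h1
    refine twoForm_ext fun X Y => ?_
    have := key (0, X) (0, Y)
    rw [h1] at this
    simpa using this.symm
  · intro h1
    refine twoForm_ext fun a b => ?_
    rw [key, h1]
    simp

end IsRaczWald

end Quotient
-- The torsion of the bifurcation surface
section Torsion

variable {m : ℕ}

theorem surfaceIncl_apply (X : XSpace m) : surfaceIncl m X = (0, 0, X) := rfl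

theorem isOpen_surfaceDomain {D : Set (RWSpace m)} (hD : IsOpen D) : IsOpen (surfaceDomain D) :=
  hD.preimage (surfaceIncl m).continuous

namespace IsRaczWald

variable {g : RWSpace m → RWSpace m →L[ℝ] RWSpace m →L[ℝ] ℝ}
  {ξ : RWSpace m → RWSpace m} {D : Set (RWSpace m)} {G : ℝ × XSpace m → ℝ}
  {q : ℝ × XSpace m → XSpace m →L[ℝ] ℝ}
  {γ : ℝ × XSpace m → XSpace m →L[ℝ] XSpace m →L[ℝ] ℝ}

theorem metric_surface (h : IsRaczWald g ξ D G q γ) {x : XSpace m} (hx : x ∈ surfaceDomain D)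
    (v w : RWSpace m) :
    g (surfaceIncl m x) v w
      = G (0, x) / 2 * (v.1 * w.2.1 + w.1 * v.2.1) + γ (0, x) v.2.2 w.2.2 := by
  rw [surfaceIncl_apply, h.metric_eq _ hx, rwForm]
  simp [toS]

theorem G_surface_pos (h : IsRaczWald g ξ D G q γ) {x : XSpace m} (hx : x ∈ surfaceDomain D) :
    0 < G (0, x) := by
  simpa [toS] using h.G_pos _ hx

theorem contDiffAt_G_surface (h : IsRaczWald g ξ D G q γ) {x : XSpace m}
    (hx : x ∈ surfaceDomain D) : ContDiffAt ℝ ∞ (fun x : XSpace m => G (0, x)) x :=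
  (h.contDiffOn_G.contDiffAt (h.isOpen_image.mem_nhds (mem_image_surface hx))).comp x
    (contDiffAt_const.prodMk contDiffAt_id)

theorem fderiv_G_surface (h : IsRaczWald g ξ D G q γ) {x : XSpace m} (hx : x ∈ surfaceDomain D)
    (X : XSpace m) : fderiv ℝ (fun x : XSpace m => G (0, x)) x X = fderiv ℝ G (0, x) (0, X) := by
  have h1 := ((h.contDiffOn_G.contDiffAt (h.isOpen_image.mem_nhds
    (mem_image_surface hx))).differentiableAt (by simp)).hasFDerivAt.comp x
    (hasFDerivAt_prodMk_right (0 : ℝ) x)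
  have h2 : HasFDerivAt (fun x : XSpace m => G (0, x)) _ x := h1
  rw [h2.fderiv]
  simp

/-- On `S` the differential of `UV` is zero, so the metric functions contribute only their `x`
derivatives. The middle term comes from the explicit factor `V` in front of `q_a`; it is the source
of `q` in the torsion. -/
theorem fderiv_metric_surface (h : IsRaczWald g ξ D G q γ) {x : XSpace m}
    (hx : x ∈ surfaceDomain D) (u v w : RWSpace m) :
    fderiv ℝ g (surfaceIncl m x) u v w
      = fderiv ℝ G (0, x) (0, u.2.2) / 2 * (v.1 * w.2.1 + w.1 * v.2.1)
        + G (0, x) / 2 * (u.2.1 * (v.1 * q (0, x) w.2.2 + w.1 * q (0, x) v.2.2))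
        + fderiv ℝ γ (0, x) (0, u.2.2) v.2.2 w.2.2 := by
  set y := surfaceIncl m x with hy
  have hyD : y ∈ D := hx
  have hyS : toS y = (0, x) := by simp [hy, surfaceIncl_apply, toS]
  have h2 : HasFDerivAt (fun y : RWSpace m => y.2.1) ((ContinuousLinearMap.fst ℝ ℝ (XSpace m)).comp
      (ContinuousLinearMap.snd ℝ ℝ (ℝ × XSpace m))) y :=
    hasFDerivAt_fst.comp y hasFDerivAt_snd
  have hγ : HasFDerivAt (fun z => γ (toS z)) ((fderiv ℝ γ (toS y)).comp (toSDeriv y)) y :=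
    ((h.contDiffOn_γ.contDiffAt (h.isOpen_image.mem_nhds ⟨y, hyD, rfl⟩)).differentiableAt
      (by simp)).hasFDerivAt.comp y (hasFDerivAt_toS y)
  have hγ' := (hγ.clm_apply (hasFDerivAt_const v.2.2 y)).clm_apply (hasFDerivAt_const w.2.2 y)
  have h3 := (((h.hasFDerivAt_G hyD).mul_const (2 : ℝ)⁻¹).mul
    ((((h2.mul (h.hasFDerivAt_q_apply hyD w.2.2)).const_add w.2.1).const_mul v.1).add
      (((h2.mul (h.hasFDerivAt_q_apply hyD v.2.2)).const_add v.2.1).const_mul w.1))).add hγ'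
  have h4 : (fun z => g z v w) =ᶠ[𝓝 y] fun z => G (toS z) * (2 : ℝ)⁻¹ *
      (v.1 * (w.2.1 + z.2.1 * q (toS z) w.2.2) + w.1 * (v.2.1 + z.2.1 * q (toS z) v.2.2))
        + γ (toS z) v.2.2 w.2.2 := by
    filter_upwards [h.isOpen.mem_nhds hyD] with z hz
    rw [h.metric_eq z hz, rwForm, div_eq_mul_inv]
  have hg := h.differentiableAt_metric hyD
  have hgv : DifferentiableAt ℝ (fun z => g z v) y := hg.clm_apply (differentiableAt_const v)
  have h5 : fderiv ℝ g y u v w = fderiv ℝ (fun z => g z v w) y u := by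
    rw [← fderiv_apply_const hgv, fderiv_clm_apply hg (differentiableAt_const v)]
    simp
  have hz1 : y.1 = 0 := rfl
  have hz2 : y.2.1 = 0 := rfl
  rw [h5, h4.fderiv_eq]
  erw [h3.fderiv]
  simp [hyS, toSDeriv_apply, hz1, hz2]
  ring

/-- A normal of the bifurcation surface lies in the span of `∂_U` and `∂_V`. -/
theorem normal_tangential_eq_zero (h : IsRaczWald g ξ D G q γ) {x : XSpace m}
    (hx : x ∈ surfaceDomain D) {v : RWSpace m}
    (hv : ∀ X, g (surfaceIncl m x) v (surfaceIncl m X) = 0) : v.2.2 = 0 := by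
  by_contra h0
  have h1 := h.γ_pos _ hx _ h0
  -- Pairing `v` with its own tangential part leaves exactly the value of `γ` on that part.
  have h2 := hv v.2.2
  rw [h.metric_surface hx, surfaceIncl_apply] at h2
  simp [toS] at h1 h2
  exact h1.ne' h2

/-- The torsion of the bifurcation surface in terms of the `U` and `V` components of the null
normals. -/
theorem torsion_eq (h : IsRaczWald g ξ D G q γ) {k l : XSpace m → RWSpace m}
    (hf : IsNullNormalFrame g (surfaceDomain D) k l) {x : XSpace m} (hx : x ∈ surfaceDomain D)
    (X : XSpace m) :
    torsion g k l x X
      = G (0, x) / 2 * ((k x).1 * (fderiv ℝ l x X).2.1 + (fderiv ℝ l x X).1 * (k x).2.1)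
        - fderiv ℝ G (0, x) (0, X) / (2 * G (0, x))
        + G (0, x) / 4 * ((l x).2.1 * (k x).1 - (k x).2.1 * (l x).1) * q (0, x) X := by
  have hk0 := h.normal_tangential_eq_zero hx (hf.normal_k x hx)
  have hl0 := h.normal_tangential_eq_zero hx (hf.normal_l x hx)
  have hG := (h.G_surface_pos hx).ne'
  have hn := hf.normalized x hx
  rw [h.metric_surface hx, hk0, hl0] at hn
  simp only [map_zero, add_zero] at hn
  have hn' : (k x).1 * (l x).2.1 + (l x).1 * (k x).2.1 = -2 / G (0, x) := by
    field_simp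
    linarith
  simp only [torsion, christoffelFirst, add_apply, ContinuousLinearMap.comp_apply, smul_apply,
    sub_apply, ContinuousLinearMap.flip_apply, h.metric_surface hx, h.fderiv_metric_surface hx]
  have e0 : ((0 : ℝ), (0 : XSpace m)) = 0 := rfl
  have hn'' : (l x).1 * (k x).2.1 = -2 / G (0, x) - (k x).1 * (l x).2.1 := by
    linarith
  -- By the normalization `g(k, l) = -1`, the term `(∂_X g)(l, k)` is a logarithmic derivative of
  -- `G`.
  have hd : fderiv ℝ G (0, x) (0, X) / 2 * ((l x).1 * (k x).2.1 + (k x).1 * (l x).2.1)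
      = - (fderiv ℝ G (0, x) (0, X) / G (0, x)) := by
    rw [hn'']
    ring
  simp only [hk0, hl0, surfaceIncl_apply, e0, map_zero, zero_apply, smul_eq_mul, hd]
  field_simp
  ring

theorem differentiableAt_q_surface (h : IsRaczWald g ξ D G q γ) {x : XSpace m}
    (hx : x ∈ surfaceDomain D) : DifferentiableAt ℝ (fun x : XSpace m => q (0, x)) x :=
  (h.hasFDerivAt_q_surface hx).differentiableAt

/-- If the torsion is near `x` of the form `c q - d (log (G |b|²)) / 2` then its exterior
derivative is `c dq`. -/
theorem dOne_eq_of_log_form (h : IsRaczWald g ξ D G q γ) {x : XSpace m}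
    (hx : x ∈ surfaceDomain D) {T : XSpace m → XSpace m →L[ℝ] ℝ} {b : XSpace m → ℝ} (c : ℝ)
    (hb : ContDiffAt ℝ ∞ b x) (hb0 : b x ≠ 0)
    (hT : ∀ᶠ z in 𝓝 x, ∀ X, T z X
      = -(fderiv ℝ b z X / b z) - fderiv ℝ G (0, z) (0, X) / (2 * G (0, z)) + c * q (0, z) X) :
    dOne T x = c • dOne (fun x : XSpace m => q (0, x)) x := by
  have hG := h.contDiffAt_G_surface hx
  -- A primitive of the part of `T` without `q`. `Real.log` is the logarithm of the absolute value,
  -- so the sign of `b` is irrelevant.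
  let f : XSpace m → ℝ := fun z => -Real.log (b z) - (1 / 2 : ℝ) * Real.log (G (0, z))
  have hfd : ContDiffAt ℝ ∞ f x :=
    (hb.log hb0).neg.sub (contDiffAt_const.mul (hG.log (h.G_surface_pos hx).ne'))
  rw [← dOne_fderiv_add_smul c hfd (h.differentiableAt_q_surface hx)]
  apply dOne_congr
  have hbd : ∀ᶠ z in 𝓝 x, DifferentiableAt ℝ b z := by
    have h1 : ContDiffAt ℝ 1 b x := hb.of_le (by norm_num)
    filter_upwards [h1.eventually (by simp)] with z hz using hz.differentiableAt one_ne_zero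
  filter_upwards [hT, hbd, hb.continuousAt.eventually_ne hb0,
    (isOpen_surfaceDomain h.isOpen).mem_nhds hx] with z hTz hbz hbz0 hz
  refine ContinuousLinearMap.ext fun X => ?_
  have hGz := ((h.contDiffAt_G_surface hz).differentiableAt (by simp)).hasFDerivAt
  have h1 : HasFDerivAt f _ z :=
    (hbz.hasFDerivAt.log hbz0).neg.sub ((hGz.log (h.G_surface_pos hz).ne').const_mul (1 / 2 : ℝ))
  rw [hTz, h1.fderiv]
  simp [h.fderiv_G_surface hz]
  field_simp

/-- The exterior derivative of the torsion of the bifurcation surface is `∓ ½ dq`. -/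
theorem dOne_torsion (h : IsRaczWald g ξ D G q γ) {k l : XSpace m → RWSpace m}
    (hf : IsNullNormalFrame g (surfaceDomain D) k l) {x : XSpace m} (hx : x ∈ surfaceDomain D) :
    ∃ c : ℝ, c ≠ 0 ∧ dOne (torsion g k l) x = c • dOne (fun x : XSpace m => q (0, x)) x := by
  have hW := (isOpen_surfaceDomain h.isOpen).mem_nhds hx
  have hl := hf.contDiffOn_l.contDiffAt hW
  have hl1 : ContDiffAt ℝ ∞ (fun z => (l z).1) x := hl.fst
  have hl2 : ContDiffAt ℝ ∞ (fun z => (l z).2.1) x := hl.snd.fst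
  have hcomp : ∀ z ∈ surfaceDomain D, ∀ X, (fderiv ℝ l z X).1 = fderiv ℝ (fun z => (l z).1) z X ∧
      (fderiv ℝ l z X).2.1 = fderiv ℝ (fun z => (l z).2.1) z X := by
    intro z hz X
    have hd := ((hf.contDiffOn_l.contDiffAt ((isOpen_surfaceDomain h.isOpen).mem_nhds
      hz)).differentiableAt (by simp)).hasFDerivAt
    have h1 : HasFDerivAt (fun z => (l z).1) _ z := hd.fst
    have h2 : HasFDerivAt (fun z => (l z).2.1) _ z := hd.snd.fst
    rw [h1.fderiv, h2.fderiv]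
    exact ⟨rfl, rfl⟩
  have alg : ∀ z ∈ surfaceDomain D, (k z).1 * (k z).2.1 = 0 ∧ (l z).1 * (l z).2.1 = 0 ∧
      G (0, z) / 2 * ((k z).1 * (l z).2.1 + (l z).1 * (k z).2.1) = -1 := by
    intro z hz
    have hk0 := h.normal_tangential_eq_zero hz (hf.normal_k z hz)
    have hl0 := h.normal_tangential_eq_zero hz (hf.normal_l z hz)
    have hG := (h.G_surface_pos hz).ne'
    have hn := hf.normalized z hz
    have hnk := hf.null_k z hz
    have hnl := hf.null_l z hz
    rw [h.metric_surface hz] at hn hnk hnl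
    simp only [hk0, hl0, map_zero, add_zero] at hn hnk hnl
    refine ⟨?_, ?_, hn⟩
    · refine mul_left_cancel₀ hG ?_
      linarith
    · refine mul_left_cancel₀ hG ?_
      linarith
  -- Nullness forces one component of `l` to vanish. The other is nonzero at `x`, hence nearby by
  -- continuity, so `l` keeps its direction on a neighbourhood and `c` is constant there: `½` along
  -- `∂_U`, `-½` along `∂_V`.
  by_cases hb : (l x).2.1 = 0
  · have hb' : (l x).1 ≠ 0 := by
      intro h0
      have := (alg x hx).2.2
      simp [hb, h0] at this
    refine ⟨1 / 2, by norm_num, h.dOne_eq_of_log_form hx _ hl1 hb' ?_⟩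
    filter_upwards [hl1.continuousAt.eventually_ne hb', hW] with z hz0 hz X
    obtain ⟨a1, a2, a3⟩ := alg z hz
    have a4 : (l z).2.1 = 0 := (mul_eq_zero.1 a2).resolve_left hz0
    rw [a4, mul_zero, zero_add] at a3
    have a5 : (k z).2.1 ≠ 0 := by
      intro h0
      simp [h0] at a3
    have a6 : (k z).1 = 0 := (mul_eq_zero.1 a1).resolve_right a5
    have hG := (h.G_surface_pos hz).ne'
    have a7 : (k z).2.1 = -2 / (G (0, z) * (l z).1) := by
      field_simp
      linarith
    rw [h.torsion_eq hf hz, (hcomp z hz X).1, a4, a6, a7]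
    field_simp
    ring
  · refine ⟨-(1 / 2), by norm_num, h.dOne_eq_of_log_form hx _ hl2 hb ?_⟩
    filter_upwards [hl2.continuousAt.eventually_ne hb, hW] with z hz0 hz X
    obtain ⟨a1, a2, a3⟩ := alg z hz
    have a4 : (l z).1 = 0 := (mul_eq_zero.1 a2).resolve_right hz0
    rw [a4, zero_mul, add_zero] at a3
    have a5 : (k z).1 ≠ 0 := by
      intro h0
      simp [h0] at a3
    have a6 : (k z).2.1 = 0 := (mul_eq_zero.1 a1).resolve_left a5
    have hG := (h.G_surface_pos hz).ne'
    have a7 : (k z).1 = -2 / (G (0, z) * (l z).2.1) := by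
      field_simp
      linarith
    rw [h.torsion_eq hf hz, (hcomp z hz X).2, a4, a6, a7]
    field_simp
    ring

end IsRaczWald

end Torsion

/-! ### From the atlas to the local statements -/

section Atlas

variable {m : ℕ} {M : Type*} [TopologicalSpace M]
  [ChartedSpace (EuclideanSpace ℝ (Fin (m + 2))) M] [IsManifold (𝓡 (m + 2)) ∞ M]

theorem RWAtlas.isRaczWald {g : LorentzianMetric (m + 2) M}
    {ξ : ∀ p : M, TangentSpace (𝓡 (m + 2)) p} {S : Set M} {ι : Type*} (A : RWAtlas g ξ S ι)
    (i : ι) :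
    IsRaczWald (coordBilin g.inner (A.chart i)) (coordVec ξ (A.chart i)) (A.chart i).target
      (A.G i) (A.q i) (A.γ i) where
  isOpen := (A.chart i).open_target
  contDiffOn_G := A.contDiffOn_G i
  contDiffOn_q := A.contDiffOn_q i
  contDiffOn_γ := A.contDiffOn_γ i
  G_pos := A.G_pos i
  γ_pos := A.γ_pos i
  metric_eq := A.metric_eq i
  killing_eq := A.killing_eq i

end Atlas

end RaczWald

theorem mainTheorem4 {m : ℕ} {M : Type*} [TopologicalSpace M]
    [ChartedSpace (EuclideanSpace ℝ (Fin (m + 2))) M] [IsManifold (𝓡 (m + 2)) ∞ M]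
    (g : RaczWald.LorentzianMetric (m + 2) M) (ξ : ∀ p : M, TangentSpace (𝓡 (m + 2)) p)
    (S : Set M) {ι : Type*} (A : RaczWald.RWAtlas g ξ S ι) (σ τ : ℤˣ) :
    -- `λ⁻² Ω̂` extends smoothly to the boundary of the quotient space
    (∀ i, ∃ B : ℝ × RaczWald.XSpace m → (ℝ × RaczWald.XSpace m) [⋀^Fin 2]→L[ℝ] ℝ,
      RaczWald.IsRescaledTwist (RaczWald.coordBilin g.inner (A.chart i))
        (RaczWald.coordVec ξ (A.chart i)) (A.chart i).target σ τ B ∧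
      ContDiffOn ℝ ∞ B (RaczWald.quotientDomain (A.chart i).target σ τ ∪
        RaczWald.quotientBoundary (A.chart i).target)) ∧
    -- the continuous extension vanishes on the boundary if and only if the torsion is closed
    (∀ B : ι → ℝ × RaczWald.XSpace m → (ℝ × RaczWald.XSpace m) [⋀^Fin 2]→L[ℝ] ℝ,
      (∀ i, RaczWald.IsRescaledTwist (RaczWald.coordBilin g.inner (A.chart i))
        (RaczWald.coordVec ξ (A.chart i)) (A.chart i).target σ τ (B i)) →
      (∀ i, ContinuousOn (B i) (RaczWald.quotientDomain (A.chart i).target σ τ ∪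
        RaczWald.quotientBoundary (A.chart i).target)) →
      ∀ k l : ι → RaczWald.XSpace m → RaczWald.RWSpace m,
      (∀ i, RaczWald.IsNullNormalFrame (RaczWald.coordBilin g.inner (A.chart i))
        (RaczWald.surfaceDomain (A.chart i).target) (k i) (l i)) →
      ((∀ i, ∀ c ∈ RaczWald.quotientBoundary (A.chart i).target, B i c = 0) ↔
        (∀ i, ∀ x ∈ RaczWald.surfaceDomain (A.chart i).target,
          RaczWald.dOne (RaczWald.torsion (RaczWald.coordBilin g.inner (A.chart i))
            (k i) (l i)) x = 0))) := by
  have hsub : ∀ i, RaczWald.quotientDomain (A.chart i).target σ τ ∪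
      RaczWald.quotientBoundary (A.chart i).target ⊆
      RaczWald.squareMap m (RaczWald.quadrantSign σ τ) ⁻¹' (RaczWald.toS '' (A.chart i).target) :=
    fun i => union_subset (RaczWald.quotientDomain_subset _ σ τ)
      (RaczWald.quotientBoundary_subset _ _)
  have hsmooth := fun i =>
    ((A.isRaczWald i).contDiffOn_rescaledTwist (RaczWald.quadrantSign σ τ)).mono (hsub i)
  refine ⟨fun i => ⟨RaczWald.rescaledTwist (RaczWald.quadrantSign σ τ) (A.q i),
    (A.isRaczWald i).isRescaledTwist_iff.2 fun _ _ => rfl, hsmooth i⟩, ?_⟩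
  intro B hB hBc k l hkl
  -- Both conditions are local, so the equivalence holds chart by chart, and in fact point by point;
  -- no compatibility of the frames between charts is needed.
  refine forall_congr' fun i => ?_
  have h := A.isRaczWald i
  -- Two continuous forms that agree on the quotient agree on its boundary, so `B i` may be replaced
  -- by the explicit `-¼ dq`.
  have hEq := (h.isRescaledTwist_iff.1 (hB i)).of_subset_closure (hBc i) (hsmooth i).continuousOn
    subset_union_left (union_subset subset_closure
      (RaczWald.quotientBoundary_subset_closure h.isOpen σ τ))
  have hiff : ∀ x ∈ RaczWald.surfaceDomain (A.chart i).target, (B i (0, x) = 0 ↔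
      RaczWald.dOne (RaczWald.torsion (RaczWald.coordBilin g.inner (A.chart i)) (k i) (l i)) x
        = 0) := by
    intro x hx
    obtain ⟨c, hc, hd⟩ := h.dOne_torsion (hkl i) hx
    rw [hEq (Or.inr ⟨rfl, hx⟩), h.rescaledTwist_boundary_eq_zero_iff _ hx, hd, smul_eq_zero,
      or_iff_right hc]
  constructor
  · exact fun h0 x hx => (hiff x hx).1 (h0 (0, x) ⟨rfl, hx⟩)
  · rintro h0 ⟨z, x⟩ ⟨hz, hx⟩
    simp only at hz
    subst hz
    exact (hiff x hx).2 (h0 x hx)
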